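/- Let $p,q\ge 0$ be integers with $n=p+q$ odd, let $\eta=(\eta^{ab})=\mathrm{diag}(1,\dots,1,-1,\dots,-1)$ with $p$ entries $+1$ followed by $q$ entries $-1$, and let $\mathcal{C}\ell^{\mathbb C}(p,q)$ be the complex Clifford algebra with identity $e$ and generators $e^1,\dots,e^n$ satisfying $e^ae^b+e^be^a=2\eta^{ab}e$. For a family $\gamma^1,\dots,\gamma^n$ of elements and a multi-index $A=\{a_1<\dots<a_k\}\subseteq\{1,\dots,n\}$ write $|A|=k$, $\gamma^A=\gamma^{a_1}\cdots\gamma^{a_k}$ (with $\gamma^{\varnothing}=e$), $\gamma_A=(\gamma^A)^{-1}$, $\gamma^{1\dots n}=\gamma^1\cdots\gamma^n$, $\gamma_{1\dots n}=(\gamma^{1\dots n})^{-1}$, and $e^{1\dots n}=e^1\cdots e^n$. The family is said to generate a basis if the $2^n$ elements $\gamma^A$ form a basis of $\mathcal{C}\ell^{\mathbb C}(p,q)$. Suppose that $\gamma^a,\beta^a\in\mathcal{C}\ell^{\mathbb C}(p,q)$, $a=1,\dots,n$, satisfy $$\gamma^a\gamma^b+\gamma^b\gamma^a=2\eta^{ab}e,\qquad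 \beta^a\beta^b+\beta^b\beta^a=2\eta^{ab}e\qquad\text{for all } a,b.$$ Consider the six cases with factors $c_1=e$, $c_2=-e$, $c_3=e^{1\dots n}$, $c_4=-e^{1\dots n}$, $c_5=ie^{1\dots n}$, $c_6=-ie^{1\dots n}$, where case $k$ means that $\beta^{1\dots n}=c_k\gamma^{1\dots n}$. Then: (i) If $p-q\equiv1\pmod 4$, then each of the two families either has top product ($\gamma^{1\dots n}$, respectively $\beta^{1\dots n}$) equal to $\pm e^{1\dots n}$ and generates a basis, or has top product equal to $\pm e$ and does not generate a basis; moreover one of the cases 1, 2, 3, 4 holds. (ii) If $p-q\equiv3\pmod 4$, then each of the two families either has top product equal to $\pm e^{1\dots n}$ and generates a basis, or has top product equal to $\pm ie$ and does not generate a basis; moreover one of the cases 1, 2, 5, 6 holds. (iii) Exactly one of the six cases holds. (iv) For each $k=1,\dots,6$, there exists an invertible element $T$ such that $$\gamma^a=c_k\,T^{-1}\beta^aT\quad\text{for all } a=1,\dots,n$$ if and only if $\beta^{1\dots n}=c_k\gamma^{1\dots n}$. If $T$ is such an element, then the set of all such elements is $\{zT\}$, where $z$ runs over the invertible elements of the center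 of $\mathcal{C}\ell^{\mathbb C}(p,q)$. (v) An invertible $T$ satisfies one of the six relations in (iv) if and only if $\gamma^a=(\beta^{1\dots n}\gamma_{1\dots n})\,T^{-1}\beta^aT$ for all $a=1,\dots,n$. (vi) For each $k$ with $\beta^{1\dots n}=c_k\gamma^{1\dots n}$, there are multi-indices $A,B$ with $|A|,|B|$ even (possibly $A=B$) such that, with $U=\gamma^A+\gamma^B$, the element $$T=H_{\mathrm{Even}}(U)=\frac1{2^{n-1}}\sum_{|C|\ \text{even}}\beta^C\,U\,\gamma_C$$ is invertible and satisfies $\gamma^a=c_k\,T^{-1}\beta^aT$ for all $a=1,\dots,n$. -/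

import Mathlib

namespace PauliClifford

noncomputable section

/-- The diagonal entries of `η`: the first `p` are `+1`, the remaining `q` are `-1`. -/
def sig (p q : ℕ) (a : Fin (p + q)) : ℂ := if (a : ℕ) < p then 1 else -1

/-- The matrix `η = diag(1, …, 1, -1, …, -1)`. -/
def eta (p q : ℕ) : Matrix (Fin (p + q)) (Fin (p + q)) ℂ := Matrix.diagonal (sig p q)

/-- The quadratic form `∑ a, η^{aa} x_a ^ 2` on `ℂ ^ (p + q)`. -/
def form (p q : ℕ) : QuadraticForm ℂ (Fin (p + q) → ℂ) :=
  QuadraticMap.weightedSumSquares ℂ (sig p q)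

/-- The complex Clifford algebra of signature `(p, q)`. -/
abbrev Cl (p q : ℕ) : Type := CliffordAlgebra (form p q)

/-- The fixed generators `e^a`. -/
def gen (p q : ℕ) (a : Fin (p + q)) : Cl p q := CliffordAlgebra.ι (form p q) (Pi.single a 1)

/-- For `A = {a₁ < ⋯ < a_k}`, the product `γ^A = γ^{a₁} ⋯ γ^{a_k}` (and `γ^∅ = 1`). -/
def mprod {M : Type*} [Monoid M] {n : ℕ} (γ : Fin n → M) (A : Finset (Fin n)) : M :=
  ((A.sort (· ≤ ·)).map γ).prod

/-- The product `γ^{1…n} = γ^1 ⋯ γ^n` of the whole family. -/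
def top {M : Type*} [Monoid M] {n : ℕ} (γ : Fin n → M) : M := mprod γ Finset.univ

/-- The element `e^{1…n}`. -/
def vol (p q : ℕ) : Cl p q := top (gen p q)

/-- The relations `γ^a γ^b + γ^b γ^a = 2 η^{ab} e`. -/
def Anticommutes {p q : ℕ} (γ : Fin (p + q) → Cl p q) : Prop :=
  ∀ a b, γ a * γ b + γ b * γ a = (2 * eta p q a b) • (1 : Cl p q)

/-- The `2 ^ n` products `γ^A` form a basis of the Clifford algebra. -/
def GeneratesBasis {p q : ℕ} (γ : Fin (p + q) → Cl p q) : Prop :=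
  LinearIndependent ℂ (mprod γ) ∧ Submodule.span ℂ (Set.range (mprod γ)) = ⊤

/-- `H_Even(U) = 2^{-(n-1)} ∑_{|A| even} β^A U γ_A`, where `γ_A = (γ^A)⁻¹`. -/
def HEven {p q : ℕ} (β γ : Fin (p + q) → Cl p q) (U : Cl p q) : Cl p q :=
  ((2 : ℂ) ^ (p + q - 1))⁻¹ •
    ∑ A : Finset (Fin (p + q)) with Even A.card, mprod β A * U * Ring.inverse (mprod γ A)

/-- The relation `γ^a = c T⁻¹ β^a T` for all `a`. -/
def Rel {p q : ℕ} (β γ : Fin (p + q) → Cl p q) (c : Cl p q) (T : (Cl p q)ˣ) : Prop :=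
  ∀ a, γ a = c * ((↑T⁻¹ : Cl p q) * β a * (T : Cl p q))

/-- The factors `1, -1, e^{1…n}, -e^{1…n}, i e^{1…n}, -i e^{1…n}` of the six cases, in this order
(numbered from `0`). -/
def factor (p q : ℕ) : Fin 6 → Cl p q :=
  ![1, -1, vol p q, -vol p q, Complex.I • vol p q, -(Complex.I • vol p q)]

end

end PauliClifford

namespace PauliClifford

open Finset

variable {p q : ℕ}

/-! ### Multi-index products and their signs. -/

section Products

variable {γ : Fin (p + q) → Cl p q}

/-! Since n is odd, the even products of any such family behave like a basis of matrix units.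
Averaging over conjugation by them fixes 1 and kills every other even product (`HEven_one`,
`HEven_mprod`). Hence each element expands uniquely in the 2^(n-1) even products with coefficients
in their centralizer, and counting dimensions shows that this centralizer has dimension 2. It
contains 1 and e^{1…n}, so it is their span, which is central. The top product therefore has the
form a + b e^{1…n}; its square is a known sign, which leaves only the listed values and hence the
six cases.

For two families, `HEven β γ U` intertwines their even products. The two central idempotents split
the algebra into blocks, and a Schur-type argument makes an intertwiner invertible as soon as it is
nonzero on both (`isUnit_of_intertwines`). The averages of the even γ^A recover everything, so
neither block kills all of them, and at most two multi-indices are needed.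

An even intertwiner also handles single generators, because γ^a γ^{1…n} is a multiple of an even
product; comparing the top products yields the factor c (`rel_of_intertwines`). Conversely,
multiplying the relations over all a and using c² = 1, n odd and centrality of the top products
gives back c (`Rel.top_eq`). -/

lemma sig_ne_zero (a : Fin (p + q)) : sig p q a ≠ 0 := by
  unfold sig; split_ifs <;> norm_num

lemma Anticommutes.mul_self (h : Anticommutes γ) (a : Fin (p + q)) :
    γ a * γ a = sig p q a • (1 : Cl p q) := by
  have h1 := h a a
  rw [eta, Matrix.diagonal_apply_eq, ← two_smul ℂ, mul_smul] at h1
  exact smul_right_injective _ (two_ne_zero) h1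

lemma Anticommutes.mul_comm_of_ne (h : Anticommutes γ) {a b : Fin (p + q)} (hab : a ≠ b) :
    γ a * γ b = -(γ b * γ a) := by
  have h1 := h a b
  rw [eta, Matrix.diagonal_apply_ne _ hab, mul_zero, zero_smul] at h1
  exact eq_neg_of_add_eq_zero_left h1

/-- The scalar is chosen before the family. This uniformity, kept in the lemmas below, lets the
constants of β and γ cancel against each other. -/
lemma exists_prod_perm {l₁ l₂ : List (Fin (p + q))} (h : l₁.Perm l₂) (hl : l₁.Nodup) :
    ∃ s : ℂ, s ≠ 0 ∧ ∀ γ : Fin (p + q) → Cl p q, Anticommutes γ →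
      (l₁.map γ).prod = s • (l₂.map γ).prod := by
  induction h with
  | nil => exact ⟨1, one_ne_zero, fun γ _ => by simp⟩
  | cons x _ ih =>
    obtain ⟨s, hs, h⟩ := ih (List.nodup_cons.1 hl).2
    exact ⟨s, hs, fun γ hγ => by simp [h γ hγ]⟩
  | swap x y l =>
    refine ⟨-1, by norm_num, fun γ hγ => ?_⟩
    have hxy : y ≠ x := by rintro rfl; simp at hl
    simp [← mul_assoc, hγ.mul_comm_of_ne hxy]
  | trans h₁ _ ih₁ ih₂ =>
    obtain ⟨s, hs, h⟩ := ih₁ hl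
    obtain ⟨t, ht, h'⟩ := ih₂ (h₁.nodup_iff.1 hl)
    exact ⟨s * t, mul_ne_zero hs ht, fun γ hγ => by rw [h γ hγ, h' γ hγ, smul_smul]⟩

@[simp] lemma mprod_empty {M : Type*} [Monoid M] {n : ℕ} (γ : Fin n → M) : mprod γ ∅ = 1 := by
  simp [mprod]

@[simp] lemma mprod_singleton {M : Type*} [Monoid M] {n : ℕ} (γ : Fin n → M) (a : Fin n) :
    mprod γ {a} = γ a := by
  simp [mprod]

lemma exists_mprod_insert {a : Fin (p + q)} {A : Finset (Fin (p + q))} (ha : a ∉ A) :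
    ∃ s : ℂ, s ≠ 0 ∧ ∀ γ : Fin (p + q) → Cl p q, Anticommutes γ →
      mprod γ (insert a A) = s • (γ a * mprod γ A) := by
  obtain ⟨s, hs, h⟩ := exists_prod_perm (p := p) (q := q)
    (l₁ := (insert a A).sort (· ≤ ·)) (l₂ := a :: A.sort (· ≤ ·)) (by
      refine (sort_perm_toList _ _).trans ((toList_insert ha).trans ?_)
      exact ((sort_perm_toList _ _).symm).cons a) (sort_nodup _ _)
  exact ⟨s, hs, fun γ hγ => by rw [mprod, h γ hγ]; simp [mprod]⟩

lemma exists_mul_mprod (a : Fin (p + q)) (A : Finset (Fin (p + q))) :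
    ∃ s : ℂ, s ≠ 0 ∧ ∀ γ : Fin (p + q) → Cl p q, Anticommutes γ →
      γ a * mprod γ A = s • mprod γ (symmDiff {a} A) := by
  by_cases ha : a ∈ A
  · obtain ⟨s, hs, h⟩ := exists_mprod_insert (notMem_erase a A)
    refine ⟨s * sig p q a, mul_ne_zero hs (sig_ne_zero a), fun γ hγ => ?_⟩
    have h1 : symmDiff {a} A = A.erase a := by ext x; simp [mem_symmDiff]; grind
    rw [insert_erase ha] at h
    rw [h1, h γ hγ, mul_smul_comm, ← mul_assoc, hγ.mul_self, smul_mul_assoc, one_mul, smul_smul]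
  · obtain ⟨s, hs, h⟩ := exists_mprod_insert ha
    refine ⟨s⁻¹, inv_ne_zero hs, fun γ hγ => ?_⟩
    have h1 : symmDiff {a} A = insert a A := by ext x; simp [mem_symmDiff]; grind
    rw [h1, h γ hγ, smul_smul, inv_mul_cancel₀ hs, one_smul]

/-- Products of multi-index elements, with structure constants independent of the family. -/
lemma exists_mprod_mul_mprod (A B : Finset (Fin (p + q))) :
    ∃ s : ℂ, s ≠ 0 ∧ ∀ γ : Fin (p + q) → Cl p q, Anticommutes γ →
      mprod γ A * mprod γ B = s • mprod γ (symmDiff A B) := by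
  induction A using Finset.induction_on with
  | empty => exact ⟨1, one_ne_zero, fun γ _ => by
      rw [mprod_empty, one_mul, one_smul, ← Finset.bot_eq_empty, bot_symmDiff]⟩
  | insert a A ha ih =>
    obtain ⟨s, hs, h⟩ := ih
    obtain ⟨t, ht, h'⟩ := exists_mprod_insert ha
    obtain ⟨u, hu, h''⟩ := exists_mul_mprod a (symmDiff A B)
    refine ⟨t * (s * u), mul_ne_zero ht (mul_ne_zero hs hu), fun γ hγ => ?_⟩
    have h1 : symmDiff (insert a A) B = symmDiff {a} (symmDiff A B) := by
      rw [← symmDiff_assoc]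
      congr 1
      ext x; simp [mem_symmDiff]; grind
    rw [h1, h' γ hγ, smul_mul_assoc, mul_assoc, h γ hγ, mul_smul_comm, h'' γ hγ, smul_smul,
      smul_smul, mul_assoc]

lemma exists_mprod_mul_self (A : Finset (Fin (p + q))) :
    ∃ s : ℂ, s ≠ 0 ∧ ∀ γ : Fin (p + q) → Cl p q, Anticommutes γ →
      mprod γ A * mprod γ A = s • 1 := by
  simpa using exists_mprod_mul_mprod A A

lemma exists_inverse_mprod (A : Finset (Fin (p + q))) :
    ∃ s : ℂ, s ≠ 0 ∧ ∀ γ : Fin (p + q) → Cl p q, Anticommutes γ →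
      IsUnit (mprod γ A) ∧ Ring.inverse (mprod γ A) = s • mprod γ A := by
  obtain ⟨s, hs, h⟩ := exists_mprod_mul_self A
  refine ⟨s⁻¹, inv_ne_zero hs, fun γ hγ => ?_⟩
  let u : (Cl p q)ˣ := ⟨mprod γ A, s⁻¹ • mprod γ A,
    by rw [mul_smul_comm, h γ hγ, smul_smul, inv_mul_cancel₀ hs, one_smul],
    by rw [smul_mul_assoc, h γ hγ, smul_smul, inv_mul_cancel₀ hs, one_smul]⟩
  exact ⟨u.isUnit, Ring.inverse_unit u⟩

lemma Anticommutes.isUnit_mprod (h : Anticommutes γ) (A : Finset (Fin (p + q))) :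
    IsUnit (mprod γ A) := by
  obtain ⟨_, _, h'⟩ := exists_inverse_mprod A
  exact (h' γ h).1

lemma Anticommutes.mprod_mul_inverse (h : Anticommutes γ) (A : Finset (Fin (p + q))) :
    mprod γ A * Ring.inverse (mprod γ A) = 1 := Ring.mul_inverse_cancel _ (h.isUnit_mprod A)

lemma Anticommutes.inverse_mul_mprod (h : Anticommutes γ) (A : Finset (Fin (p + q))) :
    Ring.inverse (mprod γ A) * mprod γ A = 1 := Ring.inverse_mul_cancel _ (h.isUnit_mprod A)

lemma Anticommutes.inverse_mul_mul (h : Anticommutes γ) (A : Finset (Fin (p + q))) (x : Cl p q) :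
    Ring.inverse (mprod γ A) * x * mprod γ A = mprod γ A * x * Ring.inverse (mprod γ A) := by
  obtain ⟨s, _, h'⟩ := exists_inverse_mprod A
  rw [(h' γ h).2]; simp

/-- Conjugation by multi-index elements composes by symmetric difference. -/
lemma conj_conj {β : Fin (p + q) → Cl p q} (hβ : Anticommutes β) (hγ : Anticommutes γ)
    (D A : Finset (Fin (p + q))) (U : Cl p q) :
    mprod β D * (mprod β A * U * Ring.inverse (mprod γ A)) * Ring.inverse (mprod γ D) =
      mprod β (symmDiff D A) * U * Ring.inverse (mprod γ (symmDiff D A)) := by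
  obtain ⟨s, hs, h⟩ := exists_mprod_mul_mprod D A
  -- The γ side contributes the inverse of the very constant s that comes from β^D β^A.
  have key : Ring.inverse (mprod γ A) * Ring.inverse (mprod γ D) =
      s⁻¹ • Ring.inverse (mprod γ (symmDiff D A)) := by
    have h1 : (mprod γ D * mprod γ A) *
        (Ring.inverse (mprod γ A) * Ring.inverse (mprod γ D)) = 1 := by
      rw [mul_assoc, ← mul_assoc (mprod γ A), hγ.mprod_mul_inverse, one_mul, hγ.mprod_mul_inverse]
    have h2 : (s⁻¹ • Ring.inverse (mprod γ (symmDiff D A))) * (mprod γ D * mprod γ A) = 1 := by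
      rw [h γ hγ, smul_mul_smul_comm, hγ.inverse_mul_mprod, inv_mul_cancel₀ hs, one_smul]
    exact (left_inv_eq_right_inv h2 h1).symm
  calc _ = (mprod β D * mprod β A) * U * (Ring.inverse (mprod γ A) * Ring.inverse (mprod γ D)) := by
        simp only [mul_assoc]
    _ = _ := by
        rw [key, h β hβ, smul_mul_assoc, smul_mul_smul_comm, mul_inv_cancel₀ hs, one_smul]

lemma Anticommutes.mul_list_prod (h : Anticommutes γ) {a : Fin (p + q)}
    {l : List (Fin (p + q))} (ha : a ∉ l) :
    γ a * (l.map γ).prod = (-1 : ℂ) ^ l.length • ((l.map γ).prod * γ a) := by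
  induction l with
  | nil => simp
  | cons b l ih =>
    rw [List.mem_cons, not_or] at ha
    rw [List.map_cons, List.prod_cons, ← mul_assoc, h.mul_comm_of_ne ha.1, neg_mul, mul_assoc,
      ih ha.2, List.length_cons, pow_succ]
    simp [mul_assoc]

lemma Anticommutes.mul_mprod_of_notMem (h : Anticommutes γ) {a : Fin (p + q)}
    {A : Finset (Fin (p + q))} (ha : a ∉ A) :
    γ a * mprod γ A = (-1 : ℂ) ^ A.card • (mprod γ A * γ a) := by
  have := h.mul_list_prod (a := a) (l := A.sort (· ≤ ·)) (by simpa using ha)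
  simpa [mprod] using this

lemma Anticommutes.mul_mprod_of_mem (h : Anticommutes γ) {a : Fin (p + q)}
    {A : Finset (Fin (p + q))} (ha : a ∈ A) :
    γ a * mprod γ A = (-1 : ℂ) ^ (A.card + 1) • (mprod γ A * γ a) := by
  obtain ⟨s, -, h1⟩ := exists_mprod_insert (notMem_erase a A)
  have h2 := h.mul_mprod_of_notMem (notMem_erase a A)
  have h3 := card_erase_add_one ha
  rw [insert_erase ha] at h1
  have h4 : ((-1 : ℂ) ^ (A.card + 1)) = (-1) ^ (A.erase a).card := by
    rw [← h3]; ring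
  rw [h1 γ h, h4, mul_smul_comm, smul_mul_assoc, smul_comm]
  congr 1
  rw [mul_assoc, ← mul_smul_comm, ← h2]

lemma Anticommutes.commute_top (h : Anticommutes γ) (hn : Odd (p + q)) (a : Fin (p + q)) :
    Commute (γ a) (top γ) := by
  have := h.mul_mprod_of_mem (mem_univ a)
  rw [card_univ, Fintype.card_fin, (hn.add_one).neg_one_pow, one_smul] at this
  exact this

/-- Moving the head past a tail of length k costs (-1)^k; these exponents add up to a binomial
coefficient. -/
lemma Anticommutes.list_prod_mul_self (h : Anticommutes γ) {l : List (Fin (p + q))}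
    (hl : l.Nodup) : (l.map γ).prod * (l.map γ).prod =
      ((-1) ^ (l.length.choose 2) * (l.map (sig p q)).prod) • (1 : Cl p q) := by
  induction l with
  | nil => simp
  | cons a l ih =>
    rw [List.nodup_cons] at hl
    have h1 := h.mul_list_prod hl.1
    have h2 : (l.map γ).prod * γ a = (-1 : ℂ) ^ l.length • (γ a * (l.map γ).prod) := by
      rw [h1, smul_smul, ← mul_pow]; simp
    have h3 : (l.length + 1).choose 2 = l.length + l.length.choose 2 := by
      rw [Nat.choose_succ_succ' _ 1]; simp
    simp only [List.map_cons, List.prod_cons, List.length_cons, h3]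
    rw [mul_assoc, ← mul_assoc _ (γ a), h2, smul_mul_assoc, mul_smul_comm, mul_assoc, ih hl.2,
      ← mul_assoc, h.mul_self, mul_smul_comm, smul_mul_assoc, mul_one, smul_smul, smul_smul,
      pow_add]
    congr 1; ring

lemma prod_sig : ∏ a, sig p q a = (-1) ^ q := by
  rw [Fin.prod_univ_add]; simp [sig]

lemma Anticommutes.top_mul_self (h : Anticommutes γ) :
    top γ * top γ = ((-1) ^ ((p + q).choose 2 + q) : ℂ) • (1 : Cl p q) := by
  have h1 := h.list_prod_mul_self (sort_nodup univ (· ≤ ·))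
  have h2 : ((univ.sort (· ≤ ·)).map (sig p q)).prod = ∏ a, sig p q a := by
    rw [← prod_map_toList]
    exact ((sort_perm_toList _ _).map _).prod_eq
  rw [h2, prod_sig, length_sort, card_univ, Fintype.card_fin, ← pow_add] at h1
  exact h1

lemma anticommutes_gen : Anticommutes (gen p q) := by
  intro a b
  rw [gen, gen, CliffordAlgebra.ι_mul_ι_add_swap, Algebra.algebraMap_eq_smul_one]
  congr 1
  rw [QuadraticMap.polar, form]
  simp only [QuadraticMap.weightedSumSquares_apply, ← sum_sub_distrib, Pi.add_apply, eta]
  rw [sum_eq_single a]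
  · by_cases hab : a = b
    · subst hab; simp; ring
    · simp [Matrix.diagonal_apply_ne _ hab, Pi.single_eq_of_ne hab]
  · intro c _ hc
    simp [Pi.single_eq_of_ne hc]
  · simp

end Products

/-! ### Averaging over the even products. -/

section Averaging

variable {β γ : Fin (p + q) → Cl p q}

lemma even_card_symmDiff {α : Type*} [DecidableEq α] {A B : Finset α} (hA : Even A.card)
    (hB : Even B.card) : Even (symmDiff A B).card := by
  have h1 : (symmDiff A B).card = (A \ B).card + (B \ A).card := by
    rw [symmDiff_def, sup_eq_union, card_union_of_disjoint disjoint_sdiff_sdiff]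
  have h2 := card_sdiff_add_card_inter A B
  have h3 := card_sdiff_add_card_inter B A
  rw [inter_comm] at h3
  grind

lemma sum_even_symmDiff {M : Type*} [AddCommMonoid M] {n : ℕ} {D : Finset (Fin n)}
    (hD : Even D.card) (f : Finset (Fin n) → M) :
    ∑ A : Finset (Fin n) with Even A.card, f (symmDiff D A) =
      ∑ A : Finset (Fin n) with Even A.card, f A := by
  refine sum_nbij' (symmDiff D) (symmDiff D) ?_ ?_ ?_ ?_ ?_
  · intro A hA; simpa using even_card_symmDiff hD (by simpa using hA)
  · intro A hA; simpa using even_card_symmDiff hD (by simpa using hA)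
  all_goals simp

lemma card_even_filter {n : ℕ} (hn : 0 < n) :
    (univ.filter fun A : Finset (Fin n) => Even A.card).card = 2 ^ (n - 1) := by
  have h1 : (univ.filter fun A : Finset (Fin n) => Even A.card).card =
      (univ.filter fun A : Finset (Fin n) => ¬ Even A.card).card := by
    -- Toggling one fixed index pairs the even subsets with the odd ones.
    have key : ∀ A : Finset (Fin n), Even (symmDiff {⟨0, hn⟩} A).card ↔ ¬ Even A.card := by
      intro A
      by_cases ha : (⟨0, hn⟩ : Fin n) ∈ A
      · have : symmDiff {⟨0, hn⟩} A = A.erase ⟨0, hn⟩ := by ext x; simp [mem_symmDiff]; grind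
        rw [this, ← card_erase_add_one ha]; grind
      · have : symmDiff {⟨0, hn⟩} A = insert ⟨0, hn⟩ A := by ext x; simp [mem_symmDiff]; grind
        rw [this, card_insert_of_notMem ha]; grind
    refine card_nbij' (symmDiff {⟨0, hn⟩}) (symmDiff {⟨0, hn⟩}) ?_ ?_ ?_ ?_
    · intro A hA
      have := key (symmDiff {⟨0, hn⟩} A)
      rw [symmDiff_symmDiff_cancel_left] at this
      simpa using this.1 (by simpa using hA)
    · intro A hA; simpa using (key A).2 (by simpa using hA)
    · intro A _; simp
    · intro A _; simp
  have h2 := card_filter_add_card_filter_not (s := (univ : Finset (Finset (Fin n))))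
    (fun A => Even A.card)
  rw [← h1, card_univ, Fintype.card_finset, Fintype.card_fin] at h2
  obtain ⟨m, rfl⟩ := Nat.exists_eq_succ_of_ne_zero hn.ne'
  rw [Nat.succ_eq_add_one, pow_succ] at h2
  simp only [Nat.succ_eq_add_one, Nat.add_sub_cancel]
  omega

lemma HEven_add (U V : Cl p q) : HEven β γ (U + V) = HEven β γ U + HEven β γ V := by
  simp only [HEven, mul_add, add_mul, sum_add_distrib, smul_add]

lemma HEven_smul (c : ℂ) (U : Cl p q) : HEven β γ (c • U) = c • HEven β γ U := by
  simp only [HEven, mul_smul_comm, smul_mul_assoc, ← smul_sum]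
  rw [smul_comm]

lemma HEven_mul_of_commute {z : Cl p q} (hz : ∀ A : Finset (Fin (p + q)), Even A.card →
    Commute z (mprod β A)) (U : Cl p q) : HEven β γ (z * U) = z * HEven β γ U := by
  rw [HEven, HEven, mul_smul_comm, mul_sum]
  congr 1
  refine sum_congr rfl fun A hA => ?_
  rw [← mul_assoc, ← (hz A (by simpa using hA)).eq]
  simp only [mul_assoc]

lemma HEven_zero : HEven β γ 0 = 0 := by simp [HEven]

lemma HEven_sum {ι : Type*} (s : Finset ι) (f : ι → Cl p q) :
    HEven β γ (∑ i ∈ s, f i) = ∑ i ∈ s, HEven β γ (f i) := by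
  classical
  induction s using Finset.induction_on with
  | empty => simp [HEven_zero]
  | insert a s ha ih => rw [sum_insert ha, sum_insert ha, HEven_add, ih]

/-- `HEven β γ U` intertwines the even products of the two families. -/
lemma mprod_mul_HEven (hβ : Anticommutes β) (hγ : Anticommutes γ) {D : Finset (Fin (p + q))}
    (hD : Even D.card) (U : Cl p q) :
    mprod β D * HEven β γ U = HEven β γ U * mprod γ D := by
  have h : mprod β D * HEven β γ U * Ring.inverse (mprod γ D) = HEven β γ U := by
    simp only [HEven]
    rw [mul_smul_comm, smul_mul_assoc, mul_sum, sum_mul]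
    simp only [conj_conj hβ hγ]
    rw [sum_even_symmDiff hD fun A => mprod β A * U * Ring.inverse (mprod γ A)]
  calc _ = mprod β D * HEven β γ U * Ring.inverse (mprod γ D) * mprod γ D := by
        rw [mul_assoc _ _ (mprod γ D), hγ.inverse_mul_mprod, mul_one]
    _ = _ := by rw [h]

lemma Anticommutes.HEven_one (h : Anticommutes γ) (hn : 0 < p + q) : HEven γ γ 1 = 1 := by
  simp only [HEven, mul_one, h.mprod_mul_inverse]
  rw [sum_const, card_even_filter hn, ← Nat.cast_smul_eq_nsmul ℂ, smul_smul, Nat.cast_pow,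
    Nat.cast_ofNat, inv_mul_cancel₀ (pow_ne_zero _ two_ne_zero), one_smul]

/-- As n is odd, an even nonempty C contains some a and misses some b, and γ^a γ^b anticommutes with
γ^C. Conjugating by it flips the sign of γ^C but only permutes the terms of the average. -/
lemma Anticommutes.HEven_mprod (h : Anticommutes γ) (hn : Odd (p + q))
    {C : Finset (Fin (p + q))} (hC : Even C.card) (hC0 : C ≠ ∅) : HEven γ γ (mprod γ C) = 0 := by
  obtain ⟨a, ha⟩ := nonempty_iff_ne_empty.2 hC0
  obtain ⟨b, hb⟩ : ∃ b, b ∉ C := by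
    by_contra! hcon
    rw [eq_univ_of_forall hcon, card_univ, Fintype.card_fin] at hC
    exact Nat.not_even_iff_odd.2 hn hC
  have hab : a ≠ b := by rintro rfl; exact hb ha
  have hca := h.mul_mprod_of_mem ha
  have hcb := h.mul_mprod_of_notMem hb
  rw [hC.add_one.neg_one_pow, neg_one_smul] at hca
  rw [hC.neg_one_pow, one_smul] at hcb
  obtain ⟨s, hs, hD⟩ := exists_mprod_insert (p := p) (q := q) (a := a) (A := {b})
    (by simpa using hab)
  have hDe : Even (insert a ({b} : Finset (Fin (p + q)))).card := by
    rw [card_pair hab]; norm_num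
  have hanti : mprod γ (insert a {b}) * mprod γ C = -(mprod γ C * mprod γ (insert a {b})) := by
    rw [hD γ h, mprod_singleton, smul_mul_assoc, mul_assoc, hcb, ← mul_assoc, hca, mul_smul_comm,
      neg_mul, smul_neg, mul_assoc]
  have hconj : mprod γ (insert a {b}) * mprod γ C * Ring.inverse (mprod γ (insert a {b})) =
      -mprod γ C := by
    rw [hanti, neg_mul, mul_assoc, h.mprod_mul_inverse, mul_one]
  have key : HEven γ γ (mprod γ (insert a {b}) * mprod γ C *
      Ring.inverse (mprod γ (insert a {b}))) = HEven γ γ (mprod γ C) := by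
    simp only [HEven, conj_conj h h]
    congr 1
    simp only [symmDiff_comm _ (insert a {b})]
    exact sum_even_symmDiff hDe fun A => mprod γ A * mprod γ C * Ring.inverse (mprod γ A)
  rw [hconj, ← neg_one_smul ℂ, HEven_smul, neg_one_smul] at key
  have h2 : (2 : ℂ) • HEven γ γ (mprod γ C) = 0 := by
    rw [two_smul]; nth_rewrite 1 [← key]; exact neg_add_cancel _
  exact (smul_eq_zero.1 h2).resolve_left two_ne_zero

/-- Every element is recovered from its averages against the even products. -/
lemma sum_HEven_mul (hγ : Anticommutes γ) (hn : Odd (p + q)) (U : Cl p q) :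
    ∑ A : Finset (Fin (p + q)) with Even A.card,
      HEven β γ (U * Ring.inverse (mprod γ A)) * mprod γ A = U := by
  -- After the sums are exchanged, the inner sum is an average of the inverse of γ^C, so only C = ∅
  -- survives.
  have h1 : ∀ C : Finset (Fin (p + q)), Even C.card →
      ((2 : ℂ) ^ (p + q - 1))⁻¹ • ∑ A : Finset (Fin (p + q)) with Even A.card,
        Ring.inverse (mprod γ A) * Ring.inverse (mprod γ C) * mprod γ A =
      if C = ∅ then 1 else 0 := by
    intro C hC
    simp only [hγ.inverse_mul_mul]
    change HEven γ γ (Ring.inverse (mprod γ C)) = _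
    obtain ⟨s, -, h'⟩ := exists_inverse_mprod C
    split_ifs with h0
    · subst h0; simp [hγ.HEven_one hn.pos]
    · rw [(h' γ hγ).2, HEven_smul, hγ.HEven_mprod hn hC h0, smul_zero]
  calc _ = ∑ C : Finset (Fin (p + q)) with Even C.card, mprod β C * U *
        (((2 : ℂ) ^ (p + q - 1))⁻¹ • ∑ A : Finset (Fin (p + q)) with Even A.card,
          Ring.inverse (mprod γ A) * Ring.inverse (mprod γ C) * mprod γ A) := by
        simp only [HEven, smul_mul_assoc, mul_smul_comm, mul_sum, sum_mul, ← smul_sum]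
        rw [sum_comm]
        simp only [mul_assoc]
    _ = ∑ C : Finset (Fin (p + q)) with Even C.card, mprod β C * U * (if C = ∅ then 1 else 0) :=
        sum_congr rfl fun C hC => by rw [h1 C (by simpa using hC)]
    _ = U := by
        rw [sum_eq_single ∅]
        · simp
        · intro C _ hC; simp [hC]
        · simp

end Averaging

/-! ### Dimension of the centralizer of the even products. -/

section Centralizer

variable {γ : Fin (p + q) → Cl p q}

/-- The centralizer of the even products of a family. -/
def evenCentralizer (γ : Fin (p + q) → Cl p q) : Subalgebra ℂ (Cl p q) :=
  Subalgebra.centralizer ℂ (mprod γ '' {A | Even A.card})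

lemma mem_evenCentralizer {z : Cl p q} :
    z ∈ evenCentralizer γ ↔ ∀ A : Finset (Fin (p + q)), Even A.card → Commute z (mprod γ A) := by
  simp only [evenCentralizer, Subalgebra.mem_centralizer_iff, Set.forall_mem_image,
    Set.mem_ofPred_eq]
  exact forall₂_congr fun A _ => eq_comm

lemma finrank_Cl : Module.finrank ℂ (Cl p q) = 2 ^ (p + q) := by
  have : Invertible (2 : ℂ) := invertibleOfNonzero two_ne_zero
  rw [(CliffordAlgebra.equivExterior (form p q)).finrank_eq,
    Module.finrank_eq_card_basis (Pi.basisFun ℂ (Fin (p + q))).ExteriorAlgebra]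
  simp

instance : FiniteDimensional ℂ (Cl p q) :=
  haveI : Invertible (2 : ℂ) := invertibleOfNonzero two_ne_zero
  haveI := Module.Finite.of_basis (Pi.basisFun ℂ (Fin (p + q))).ExteriorAlgebra
  Module.Finite.equiv (CliffordAlgebra.equivExterior (form p q)).symm

instance : Nontrivial (Cl p q) :=
  Module.nontrivial_of_finrank_pos (R := ℂ) (by rw [finrank_Cl]; positivity)

instance : IsDedekindFiniteMonoid (Cl p q) :=
  haveI : IsNoetherianRing (Cl p q) := isNoetherian_of_tower ℂ inferInstance
  inferInstance

/-- Expansion of an element in even products with coefficients in their centralizer. -/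
def evenExpansion (γ : Fin (p + q) → Cl p q) :
    ({A : Finset (Fin (p + q)) // Even A.card} → evenCentralizer γ) →ₗ[ℂ] Cl p q where
  toFun f := ∑ A, (f A : Cl p q) * mprod γ A
  map_add' f g := by simp [add_mul, sum_add_distrib]
  map_smul' c f := by simp [smul_sum]

lemma Anticommutes.evenExpansion_surjective (h : Anticommutes γ) (hn : Odd (p + q)) :
    Function.Surjective (evenExpansion γ) := by
  intro U
  refine ⟨fun A => ⟨HEven γ γ (U * Ring.inverse (mprod γ A)), mem_evenCentralizer.2 fun D hD =>
    (mprod_mul_HEven h h hD _).symm⟩, ?_⟩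
  change ∑ A : {A : Finset (Fin (p + q)) // Even A.card}, _ = _
  conv_rhs => rw [← sum_HEven_mul (β := γ) h hn U]
  exact (sum_subtype _ (by simp)
    (fun A => HEven γ γ (U * Ring.inverse (mprod γ A)) * mprod γ A)).symm

lemma Anticommutes.evenExpansion_injective (h : Anticommutes γ) (hn : Odd (p + q)) :
    Function.Injective (evenExpansion γ) := by
  rw [injective_iff_map_eq_zero]
  intro f hf
  funext C
  have hf' : ∑ A : {A : Finset (Fin (p + q)) // Even A.card}, (f A : Cl p q) * mprod γ A = 0 := hf
  -- Multiplying by the inverse of γ^C and averaging extracts the coefficient at C, since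
  -- coefficients pass through the average.
  have h1 : HEven γ γ ((∑ A : {A : Finset (Fin (p + q)) // Even A.card},
      (f A : Cl p q) * mprod γ A) * Ring.inverse (mprod γ C)) = f C := by
    rw [sum_mul, HEven_sum, sum_eq_single C]
    · rw [mul_assoc, h.mprod_mul_inverse, HEven_mul_of_commute (mem_evenCentralizer.1 (f C).2),
        h.HEven_one hn.pos, mul_one]
    · intro A _ hAC
      obtain ⟨s, -, hs⟩ := exists_inverse_mprod (p := p) (q := q) C
      obtain ⟨t, -, ht⟩ := exists_mprod_mul_mprod (p := p) (q := q) A C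
      rw [mul_assoc, HEven_mul_of_commute (mem_evenCentralizer.1 (f A).2), (hs γ h).2,
        mul_smul_comm, ht γ h, HEven_smul, HEven_smul,
        h.HEven_mprod hn (even_card_symmDiff A.2 C.2), smul_zero, smul_zero, mul_zero]
      intro h0
      exact hAC (Subtype.ext (symmDiff_eq_bot.1 h0))
    · simp
  rw [hf', zero_mul, HEven_zero] at h1
  exact Subtype.ext h1.symm

/-- The expansion is bijective, so 2^n equals 2^(n-1) times this dimension. -/
lemma Anticommutes.finrank_evenCentralizer (h : Anticommutes γ) (hn : Odd (p + q)) :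
    Module.finrank ℂ (evenCentralizer γ) = 2 := by
  have h1 := (LinearEquiv.ofBijective (evenExpansion γ)
    ⟨h.evenExpansion_injective hn, h.evenExpansion_surjective hn⟩).finrank_eq
  rw [Module.finrank_pi_fintype, finrank_Cl] at h1
  simp only [sum_const, card_univ, smul_eq_mul] at h1
  rw [Fintype.card_subtype, card_even_filter hn.pos] at h1
  have h2 : 2 ^ (p + q) = 2 ^ (p + q - 1) * 2 := by
    rw [← pow_succ, Nat.sub_add_cancel hn.pos]
  rw [h2] at h1
  exact Nat.eq_of_mul_eq_mul_left (by positivity) h1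

end Centralizer

/-! ### The center, the top product, and bases. -/

section Center

variable {γ : Fin (p + q) → Cl p q}

lemma isUnit_vol : IsUnit (vol p q) := anticommutes_gen.isUnit_mprod univ

lemma involute_vol (hn : Odd (p + q)) :
    CliffordAlgebra.involute (vol p q) = -vol p q := by
  have h : ∀ l : List (Fin (p + q)), CliffordAlgebra.involute (l.map (gen p q)).prod =
      (-1 : ℂ) ^ l.length • (l.map (gen p q)).prod := by
    intro l
    induction l with
    | nil => simp
    | cons a l ih =>
      rw [List.map_cons, List.prod_cons, map_mul, ih, gen, CliffordAlgebra.involute_ι,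
        List.length_cons, pow_succ]
      simp
  have h1 := h (univ.sort (· ≤ ·))
  rw [length_sort, card_univ, Fintype.card_fin, hn.neg_one_pow, neg_one_smul] at h1
  exact h1

/-- The grade involution fixes 1 and negates e^{1…n}, which is a product of an odd number of
generators. -/
lemma eq_zero_of_smul_one_add_smul_vol (hn : Odd (p + q)) {a b : ℂ}
    (h : a • (1 : Cl p q) + b • vol p q = 0) : a = 0 ∧ b = 0 := by
  have h1 := congrArg CliffordAlgebra.involute h
  rw [map_add, map_smul, map_smul, involute_vol hn, map_one, map_zero, smul_neg] at h1
  have h2 : (a + a) • (1 : Cl p q) = 0 := by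
    rw [add_smul]
    calc _ = (a • (1 : Cl p q) + b • vol p q) + (a • (1 : Cl p q) + -(b • vol p q)) := by abel
      _ = 0 := by rw [h, h1, add_zero]
  have ha : a = 0 := by
    have := (smul_eq_zero.1 h2).resolve_right one_ne_zero
    simpa [← two_mul] using this
  refine ⟨ha, ?_⟩
  rw [ha, zero_smul, zero_add] at h
  exact (smul_eq_zero.1 h).resolve_right isUnit_vol.ne_zero

lemma smul_one_add_smul_vol_inj (hn : Odd (p + q)) {a b c d : ℂ}
    (h : a • (1 : Cl p q) + b • vol p q = c • (1 : Cl p q) + d • vol p q) : a = c ∧ b = d := by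
  have := eq_zero_of_smul_one_add_smul_vol hn (a := a - c) (b := b - d) (by
    rw [sub_smul, sub_smul, ← sub_eq_zero.2 h]; abel)
  exact ⟨sub_eq_zero.1 this.1, sub_eq_zero.1 this.2⟩

lemma commute_vol (hn : Odd (p + q)) (x : Cl p q) : Commute (vol p q) x := by
  induction x using CliffordAlgebra.induction with
  | algebraMap r => exact (Algebra.commutes r _).symm
  | ι v =>
    have h : CliffordAlgebra.ι (form p q) v = ∑ a, v a • gen p q a := by
      conv_lhs => rw [pi_eq_sum_univ' v, map_sum]
      refine sum_congr rfl fun a _ => ?_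
      rw [map_smul, gen]
    rw [h]
    exact Commute.sum_right _ _ _ fun a _ =>
      ((anticommutes_gen.commute_top hn a).symm).smul_right _
  | mul a b ha hb => exact ha.mul_right hb
  | add a b ha hb => exact ha.add_right hb

lemma commute_smul_one_add_smul_vol (hn : Odd (p + q)) (a b : ℂ) (x : Cl p q) :
    Commute (a • (1 : Cl p q) + b • vol p q) x :=
  ((Commute.one_left x).smul_left a).add_left ((commute_vol hn x).smul_left b)

/-- For every family, the centralizer of its even products is spanned by `1` and `e^{1…n}`. -/
lemma Anticommutes.exists_of_mem_evenCentralizer (h : Anticommutes γ) (hn : Odd (p + q))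
    {z : Cl p q} (hz : z ∈ evenCentralizer γ) :
    ∃ a b : ℂ, z = a • (1 : Cl p q) + b • vol p q := by
  have hli : LinearIndependent ℂ ![(1 : Cl p q), vol p q] :=
    LinearIndependent.pair_iff.2 fun _ _ => eq_zero_of_smul_one_add_smul_vol hn
  have hle : Submodule.span ℂ (Set.range ![(1 : Cl p q), vol p q]) ≤
      Subalgebra.toSubmodule (evenCentralizer γ) := by
    rw [Submodule.span_le]
    rintro _ ⟨i, rfl⟩
    fin_cases i
    · exact one_mem (evenCentralizer γ)
    · exact mem_evenCentralizer.2 fun A _ => commute_vol hn _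
  have heq := Submodule.eq_of_le_of_finrank_eq hle (by
    rw [finrank_span_eq_card hli, Subalgebra.finrank_toSubmodule, h.finrank_evenCentralizer hn]
    simp)
  have hz' : z ∈ Subalgebra.toSubmodule (evenCentralizer γ) := hz
  rw [← heq, Matrix.range_cons, Matrix.range_cons, Matrix.range_empty, Set.union_empty,
    Set.singleton_union, Submodule.mem_span_pair] at hz'
  obtain ⟨a, b, hab⟩ := hz'
  exact ⟨a, b, hab.symm⟩

lemma commute_mprod_of_commute {z : Cl p q} (hz : ∀ a, Commute z (γ a))
    (A : Finset (Fin (p + q))) : Commute z (mprod γ A) :=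
  Commute.list_prod_right _ _ fun x hx => by
    obtain ⟨a, _, rfl⟩ := List.mem_map.1 hx
    exact hz a

lemma Anticommutes.exists_top_eq (h : Anticommutes γ) (hn : Odd (p + q)) :
    ∃ a b : ℂ, top γ = a • (1 : Cl p q) + b • vol p q :=
  h.exists_of_mem_evenCentralizer hn <| mem_evenCentralizer.2 fun A _ =>
    commute_mprod_of_commute (fun a => (h.commute_top hn a).symm) A

lemma Anticommutes.commute_top_all (h : Anticommutes γ) (hn : Odd (p + q)) (x : Cl p q) :
    Commute (top γ) x := by
  obtain ⟨a, b, hab⟩ := h.exists_top_eq hn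
  rw [hab]
  exact commute_smul_one_add_smul_vol hn a b x

lemma Anticommutes.isUnit_top (h : Anticommutes γ) : IsUnit (top γ) := h.isUnit_mprod univ

lemma exists_root (p q : ℕ) : ∃ τ : ℂ, τ ≠ 0 ∧ τ * τ = (-1) ^ ((p + q).choose 2 + q) := by
  rcases neg_one_pow_eq_or ℂ ((p + q).choose 2 + q) with h | h
  · exact ⟨1, one_ne_zero, by rw [h, one_mul]⟩
  · exact ⟨Complex.I, Complex.I_ne_zero, by rw [h, Complex.I_mul_I]⟩

lemma vol_mul_vol : vol p q * vol p q = ((-1) ^ ((p + q).choose 2 + q) : ℂ) • (1 : Cl p q) :=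
  anticommutes_gen.top_mul_self

/-- The possible values of the top product. -/
lemma Anticommutes.top_eq (h : Anticommutes γ) (hn : Odd (p + q)) {τ : ℂ}
    (hτ : τ * τ = (-1) ^ ((p + q).choose 2 + q)) :
    (top γ = vol p q ∨ top γ = -vol p q) ∨
      (top γ = τ • (1 : Cl p q) ∨ top γ = -(τ • (1 : Cl p q))) := by
  obtain ⟨a, b, hab⟩ := h.exists_top_eq hn
  have h1 := h.top_mul_self
  have hτ0 : τ ≠ 0 := by
    rintro rfl
    rw [zero_mul] at hτ
    exact pow_ne_zero _ (by norm_num : (-1 : ℂ) ≠ 0) hτ.symm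
  -- Squaring a + b e^{1…n} must give τ²; the e^{1…n} coordinate forces ab = 0.
  have h2 : (a * a + b * b * (τ * τ)) • (1 : Cl p q) + (2 * (a * b)) • vol p q =
      (τ * τ) • (1 : Cl p q) + (0 : ℂ) • vol p q := by
    rw [hτ, zero_smul, add_zero, ← h1, hab, mul_add, add_mul, add_mul, smul_mul_smul_comm,
      smul_mul_smul_comm, smul_mul_smul_comm, smul_mul_smul_comm, vol_mul_vol, one_mul, one_mul,
      mul_one, smul_smul, add_smul, two_mul, add_smul, mul_comm b a]
    abel
  obtain ⟨h3, h4⟩ := smul_one_add_smul_vol_inj hn h2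
  rcases mul_eq_zero.1 ((mul_eq_zero.1 h4).resolve_left two_ne_zero) with rfl | rfl
  · left
    have : b * b = 1 := by
      have h5 : (b * b - 1) * (τ * τ) = 0 := by linear_combination h3
      exact sub_eq_zero.1 ((mul_eq_zero.1 h5).resolve_right (mul_ne_zero hτ0 hτ0))
    rcases mul_self_eq_one_iff.1 this with rfl | rfl
    · left; simpa using hab
    · right; simpa using hab
  · right
    have : a * a = τ * τ := by linear_combination h3
    rcases mul_self_eq_mul_self_iff.1 this with rfl | rfl
    · left; simpa using hab
    · right; simpa using hab

/-- The coefficients of the even expansion lie in the span of 1 and e^{1…n} = ±γ^{1…n}, and γ^{1…n}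
γ^A is a multiple of another γ^B. So the products span, and there are exactly 2^n of them. -/
lemma Anticommutes.generatesBasis (h : Anticommutes γ) (hn : Odd (p + q))
    (ht : top γ = vol p q ∨ top γ = -vol p q) : GeneratesBasis γ := by
  have hspan : Submodule.span ℂ (Set.range (mprod γ)) = ⊤ := by
    rw [Submodule.eq_top_iff']
    intro U
    rw [← sum_HEven_mul (β := γ) h hn U]
    refine Submodule.sum_mem _ fun A _ => ?_
    obtain ⟨a, b, hab⟩ := h.exists_of_mem_evenCentralizer hn
      (z := HEven γ γ (U * Ring.inverse (mprod γ A)))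
      (mem_evenCentralizer.2 fun D hD => (mprod_mul_HEven h h hD _).symm)
    obtain ⟨s, -, hs⟩ := exists_mprod_mul_mprod (p := p) (q := q) univ A
    have hmem : ∀ B, mprod γ B ∈ Submodule.span ℂ (Set.range (mprod γ)) :=
      fun B => Submodule.subset_span ⟨B, rfl⟩
    have htop : top γ * mprod γ A ∈ Submodule.span ℂ (Set.range (mprod γ)) := by
      rw [top, hs γ h]; exact Submodule.smul_mem _ _ (hmem _)
    have hvol : vol p q * mprod γ A ∈ Submodule.span ℂ (Set.range (mprod γ)) := by
      rcases ht with ht | ht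
      · rwa [ht] at htop
      · rw [ht, neg_mul] at htop
        exact (Submodule.neg_mem_iff _).1 htop
    rw [hab, add_mul, smul_mul_assoc, smul_mul_assoc, one_mul]
    exact Submodule.add_mem _ (Submodule.smul_mem _ _ (hmem A)) (Submodule.smul_mem _ _ hvol)
  refine ⟨linearIndependent_of_top_le_span_of_card_eq_finrank hspan.ge ?_, hspan⟩
  rw [finrank_Cl, Fintype.card_finset, Fintype.card_fin]

lemma not_generatesBasis (hn : 0 < p + q) {c : ℂ} (ht : top γ = c • (1 : Cl p q)) :
    ¬ GeneratesBasis γ := by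
  rintro ⟨hli, -⟩
  have hne : (univ : Finset (Fin (p + q))) ≠ ∅ :=
    nonempty_iff_ne_empty.1 ⟨⟨0, hn⟩, mem_univ _⟩
  have h1 := hli.comp ![univ, ∅] (by
    intro i j hij
    fin_cases i <;> fin_cases j <;> simp_all [eq_comm])
  have h2 : mprod γ ∘ ![univ, ∅] = ![top γ, 1] := by
    ext i; fin_cases i <;> simp [top]
  rw [h2, LinearIndependent.pair_iff] at h1
  have := h1 1 (-c) (by rw [ht]; simp)
  exact one_ne_zero this.1

end Center

/-! ### The sign of the squared top product, from p - q mod 4. -/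

section Parity

lemma even_choose_two_add_iff {m q : ℕ} :
    Even ((2 * m + 1).choose 2 + q) ↔ Even (m + q) := by
  have h : (2 * m + 1).choose 2 = m * (2 * m) + m := by
    rw [Nat.choose_two_right, Nat.add_sub_cancel]
    apply Nat.div_eq_of_eq_mul_left two_pos
    ring
  rw [h, add_assoc, Nat.even_add]
  simp

lemma neg_one_pow_of_modEq_one {p q : ℕ} (h : (p : ℤ) - (q : ℤ) ≡ 1 [ZMOD 4]) :
    (-1 : ℂ) ^ ((p + q).choose 2 + q) = 1 := by
  obtain ⟨k, hk⟩ := h.symm.dvd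
  obtain ⟨m, hm⟩ : ∃ m, p + q = 2 * m + 1 := ⟨(p + q) / 2, by omega⟩
  rw [hm, (even_choose_two_add_iff.2 (Nat.even_iff.2 (by omega))).neg_one_pow]

lemma neg_one_pow_of_modEq_three {p q : ℕ} (h : (p : ℤ) - (q : ℤ) ≡ 3 [ZMOD 4]) :
    (-1 : ℂ) ^ ((p + q).choose 2 + q) = -1 := by
  obtain ⟨k, hk⟩ := h.symm.dvd
  obtain ⟨m, hm⟩ : ∃ m, p + q = 2 * m + 1 := ⟨(p + q) / 2, by omega⟩
  rw [hm, (Nat.not_even_iff_odd.1 fun h' => ?_ : Odd _).neg_one_pow]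
  have := Nat.even_iff.1 (even_choose_two_add_iff.1 h')
  omega

end Parity

/-! ### Invertible intertwiners of the even products. -/

section Intertwiners

variable {β γ : Fin (p + q) → Cl p q}

/-- The central idempotent attached to a square root `τ` of the square of `e^{1…n}`. -/
noncomputable def idem (p q : ℕ) (τ : ℂ) : Cl p q :=
  (1 / 2 : ℂ) • (1 : Cl p q) + (1 / (2 * τ)) • vol p q

lemma idem_ne_zero (hn : Odd (p + q)) (τ : ℂ) : idem p q τ ≠ 0 := fun h => by
  have := (eq_zero_of_smul_one_add_smul_vol hn h).1
  norm_num at this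

lemma commute_idem (hn : Odd (p + q)) (τ : ℂ) (x : Cl p q) : Commute (idem p q τ) x :=
  commute_smul_one_add_smul_vol hn _ _ x

lemma idem_add_idem_neg (τ : ℂ) : idem p q τ + idem p q (-τ) = 1 := by
  have h : 1 / (2 * -τ) = -(1 / (2 * τ)) := by rw [mul_neg, one_div_neg_eq_neg_one_div]
  rw [idem, idem, h, neg_smul]
  calc _ = (1 / 2 : ℂ) • (1 : Cl p q) + (1 / 2 : ℂ) • (1 : Cl p q) := by abel
    _ = 1 := by rw [← add_smul]; norm_num

lemma idem_mul {τ : ℂ} (hτ0 : τ ≠ 0) (hτ : τ * τ = (-1) ^ ((p + q).choose 2 + q)) (a b : ℂ) :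
    idem p q τ * (a • (1 : Cl p q) + b • vol p q) = (a + b * τ) • idem p q τ := by
  rw [idem, add_mul, mul_add, mul_add, smul_mul_smul_comm, smul_mul_smul_comm, smul_mul_smul_comm,
    smul_mul_smul_comm, vol_mul_vol, ← hτ, mul_one, one_mul, mul_one, smul_add, smul_smul,
    smul_smul, smul_smul]
  have h1 : (a + b * τ) * (1 / 2) = 1 / 2 * a + 1 / (2 * τ) * b * (τ * τ) := by field_simp
  have h2 : (a + b * τ) * (1 / (2 * τ)) = 1 / (2 * τ) * a + 1 / 2 * b := by field_simp
  rw [h1, h2, add_smul, add_smul]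
  abel

/-- Schur's lemma in one block: a reverse intertwiner times T centralizes the even γ-products, so
the idempotent turns it into a scalar multiple of itself. If every such scalar vanished, expanding 1
in averages would show that T vanishes on the block. -/
lemma exists_mul_eq_idem (hβ : Anticommutes β) (hγ : Anticommutes γ) (hn : Odd (p + q)) {τ : ℂ}
    (hτ0 : τ ≠ 0) (hτ : τ * τ = (-1) ^ ((p + q).choose 2 + q)) {T : Cl p q}
    (hT : ∀ A : Finset (Fin (p + q)), Even A.card → mprod β A * T = T * mprod γ A)
    (h0 : idem p q τ * T ≠ 0) : ∃ S, S * T = idem p q τ := by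
  have hmem : ∀ V, ∃ a b : ℂ, HEven γ β V * T = a • (1 : Cl p q) + b • vol p q := by
    refine fun V => hγ.exists_of_mem_evenCentralizer hn (mem_evenCentralizer.2 fun A hA => ?_)
    rw [commute_iff_eq, mul_assoc, ← hT A hA, ← mul_assoc, ← mprod_mul_HEven hγ hβ hA, mul_assoc]
  by_contra! hS
  have hzero : ∀ V, idem p q τ * HEven γ β V * T = 0 := by
    intro V
    obtain ⟨a, b, hab⟩ := hmem V
    have h1 : idem p q τ * HEven γ β V * T = (a + b * τ) • idem p q τ := by
      rw [mul_assoc, hab, idem_mul hτ0 hτ]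
    by_contra hne
    have hc : a + b * τ ≠ 0 := fun hc => hne (by rw [h1, hc, zero_smul])
    refine hS ((a + b * τ)⁻¹ • (idem p q τ * HEven γ β V)) ?_
    rw [smul_mul_assoc, h1, smul_smul, inv_mul_cancel₀ hc, one_smul]
  refine h0 ?_
  calc idem p q τ * T = idem p q τ * 1 * T := by rw [mul_one]
    _ = ∑ A : Finset (Fin (p + q)) with Even A.card,
        idem p q τ * (HEven γ β (1 * Ring.inverse (mprod β A)) * mprod β A) * T := by
      rw [← sum_mul, ← mul_sum, sum_HEven_mul hβ hn]
    _ = 0 := sum_eq_zero fun A hA => by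
      rw [mul_assoc, mul_assoc, hT A (by simpa using hA), ← mul_assoc, ← mul_assoc, hzero, zero_mul]

lemma isUnit_of_intertwines (hβ : Anticommutes β) (hγ : Anticommutes γ) (hn : Odd (p + q)) {τ : ℂ}
    (hτ0 : τ ≠ 0) (hτ : τ * τ = (-1) ^ ((p + q).choose 2 + q)) {T : Cl p q}
    (hT : ∀ A : Finset (Fin (p + q)), Even A.card → mprod β A * T = T * mprod γ A)
    (h1 : idem p q τ * T ≠ 0) (h2 : idem p q (-τ) * T ≠ 0) : IsUnit T := by
  obtain ⟨S₁, hS₁⟩ := exists_mul_eq_idem hβ hγ hn hτ0 hτ hT h1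
  obtain ⟨S₂, hS₂⟩ := exists_mul_eq_idem hβ hγ hn (neg_ne_zero.2 hτ0)
    (by rw [neg_mul_neg, hτ]) hT h2
  have h : (S₁ + S₂) * T = 1 := by rw [add_mul, hS₁, hS₂, idem_add_idem_neg]
  -- In a finite-dimensional algebra a left inverse is two-sided.
  exact ⟨⟨T, S₁ + S₂, mul_eq_one_symm h, h⟩, rfl⟩

lemma exists_idem_mul_HEven_ne_zero (hγ : Anticommutes γ) (hn : Odd (p + q)) (τ : ℂ) :
    ∃ A : Finset (Fin (p + q)), Even A.card ∧ idem p q τ * HEven β γ (mprod γ A) ≠ 0 := by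
  by_contra! hzero
  refine idem_ne_zero hn τ ?_
  rw [← sum_HEven_mul (β := β) hγ hn (idem p q τ)]
  refine sum_eq_zero fun A hA => ?_
  obtain ⟨s, -, hs⟩ := exists_inverse_mprod (p := p) (q := q) A
  rw [HEven_mul_of_commute (fun _ _ => commute_idem hn τ _), (hs γ hγ).2, HEven_smul,
    mul_smul_comm, hzero A (by simpa using hA), smul_zero, zero_mul]

lemma exists_isUnit_HEven (hβ : Anticommutes β) (hγ : Anticommutes γ) (hn : Odd (p + q)) :
    ∃ A B : Finset (Fin (p + q)), Even A.card ∧ Even B.card ∧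
      IsUnit (HEven β γ (mprod γ A + mprod γ B)) := by
  obtain ⟨τ, hτ0, hτ⟩ := exists_root p q
  obtain ⟨A, hA, hA1⟩ := exists_idem_mul_HEven_ne_zero (β := β) hγ hn τ
  obtain ⟨B, hB, hB1⟩ := exists_idem_mul_HEven_ne_zero (β := β) hγ hn (-τ)
  have key : ∀ C D : Finset (Fin (p + q)),
      idem p q τ * HEven β γ (mprod γ C) + idem p q τ * HEven β γ (mprod γ D) ≠ 0 →
      idem p q (-τ) * HEven β γ (mprod γ C) + idem p q (-τ) * HEven β γ (mprod γ D) ≠ 0 →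
      IsUnit (HEven β γ (mprod γ C + mprod γ D)) := fun C D h1 h2 => by
    refine isUnit_of_intertwines hβ hγ hn hτ0 hτ (fun E hE => mprod_mul_HEven hβ hγ hE _) ?_ ?_
    · rwa [HEven_add, mul_add]
    · rwa [HEven_add, mul_add]
  have hdouble : ∀ x : Cl p q, x ≠ 0 → x + x ≠ 0 := fun x hx => by
    rw [← two_smul ℂ]; exact smul_ne_zero two_ne_zero hx
  -- A and B are nonzero on the blocks of τ and -τ respectively. If one of them is nonzero on both,
  -- it is doubled; otherwise each vanishes where the other does not, so their sum works.
  by_cases hA2 : idem p q (-τ) * HEven β γ (mprod γ A) = 0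
  · by_cases hB2 : idem p q τ * HEven β γ (mprod γ B) = 0
    · exact ⟨A, B, hA, hB, key A B (by rwa [hB2, add_zero]) (by rwa [hA2, zero_add])⟩
    · exact ⟨B, B, hB, hB, key B B (hdouble _ hB2) (hdouble _ hB1)⟩
  · exact ⟨A, A, hA, hA, key A A (hdouble _ hA1) (hdouble _ hA2)⟩

/-- Up to a constant common to both families, γ^a γ^{1…n} is the product over the complement of a,
which has the even size n - 1. So T intertwines these elements, and cancelling the central top
products leaves c. -/
lemma rel_of_intertwines (hβ : Anticommutes β) (hγ : Anticommutes γ) (hn : Odd (p + q))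
    {c : Cl p q} (hc : ∀ x, Commute c x) (htop : top β = c * top γ) {T : (Cl p q)ˣ}
    (hT : ∀ A : Finset (Fin (p + q)), Even A.card → mprod β A * T = T * mprod γ A) :
    Rel β γ c T := by
  intro a
  obtain ⟨s, -, hs⟩ := exists_mul_mprod (p := p) (q := q) a univ
  have hev : Even (symmDiff {a} univ : Finset (Fin (p + q))).card := by
    rw [show (symmDiff {a} univ : Finset (Fin (p + q))) = univ.erase a by
      ext x; simp [mem_symmDiff], card_erase_of_mem (mem_univ a), card_univ, Fintype.card_fin]
    exact hn.tsub_odd odd_one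
  refine hγ.isUnit_top.mul_right_cancel ?_
  have h1 : γ a * top γ = (↑T⁻¹ : Cl p q) * (β a * top β) * T := by
    rw [top, top, hs γ hγ, hs β hβ, mul_smul_comm, smul_mul_assoc, mul_assoc, hT _ hev,
      ← mul_assoc, Units.inv_mul, one_mul]
  calc γ a * top γ = (↑T⁻¹ : Cl p q) * β a * (top β * T) := by rw [h1]; simp only [mul_assoc]
    _ = (↑T⁻¹ : Cl p q) * β a * T * (c * top γ) := by
      rw [(hβ.commute_top_all hn _).eq, htop, mul_assoc, mul_assoc, mul_assoc]
    _ = _ := by rw [← mul_assoc, ← (hc _).eq]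

end Intertwiners

/-! ### Consequences of a relation: the top products and uniqueness of T. -/

section Relations

variable {β γ : Fin (p + q) → Cl p q} {c : Cl p q} {T : (Cl p q)ˣ}

/-- Squaring the relation for one generator compares the same nonzero scalar on both sides. -/
lemma Rel.mul_self (hβ : Anticommutes β) (hγ : Anticommutes γ) (hn : 0 < p + q)
    (hc : ∀ x, Commute c x) (h : Rel β γ c T) : c * c = 1 := by
  let a : Fin (p + q) := ⟨0, hn⟩
  have h1 : γ a * γ a = c * c * ((↑T⁻¹ : Cl p q) * (β a * β a) * T) := by
    rw [h a]
    calc _ = c * (((↑T⁻¹ : Cl p q) * β a * T) * c) * ((↑T⁻¹ : Cl p q) * β a * T) := by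
          simp only [mul_assoc]
      _ = c * c * ((↑T⁻¹ : Cl p q) * β a * (T * (↑T⁻¹ : Cl p q)) * β a * T) := by
          rw [← (hc _).eq]; simp only [mul_assoc]
      _ = _ := by rw [Units.mul_inv, mul_one]; simp only [mul_assoc]
  rw [hγ.mul_self, hβ.mul_self, mul_smul_comm, mul_one, smul_mul_assoc, Units.inv_mul,
    mul_smul_comm, mul_one] at h1
  exact (smul_right_injective _ (sig_ne_zero a) h1).symm

lemma Rel.list_prod (hc : ∀ x, Commute c x) (h : Rel β γ c T) (l : List (Fin (p + q))) :
    (l.map γ).prod = c ^ l.length * ((↑T⁻¹ : Cl p q) * (l.map β).prod * T) := by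
  induction l with
  | nil => simp
  | cons a l ih =>
    rw [List.map_cons, List.prod_cons, ih, h a, List.length_cons, pow_succ', List.map_cons,
      List.prod_cons]
    calc _ = c * (((↑T⁻¹ : Cl p q) * β a * T) * c ^ l.length) *
          ((↑T⁻¹ : Cl p q) * (l.map β).prod * T) := by simp only [mul_assoc]
      _ = c * c ^ l.length * ((↑T⁻¹ : Cl p q) * β a * (T * (↑T⁻¹ : Cl p q)) *
          (l.map β).prod * T) := by
        rw [← ((hc _).pow_left l.length).eq]; simp only [mul_assoc]
      _ = _ := by rw [Units.mul_inv, mul_one]; simp only [mul_assoc]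

lemma Rel.top_eq (hβ : Anticommutes β) (hγ : Anticommutes γ) (hn : Odd (p + q))
    (hc : ∀ x, Commute c x) (h : Rel β γ c T) : top β = c * top γ := by
  have hcc := h.mul_self hβ hγ hn.pos hc
  have hpow : c ^ (p + q) = c := by
    obtain ⟨m, hm⟩ := hn
    calc c ^ (p + q) = c ^ (2 * m + 1) := congrArg (c ^ ·) hm
      _ = c := by rw [pow_succ, pow_mul, pow_two, hcc, one_pow, one_mul]
  have h1 : top γ = c ^ (univ.sort (· ≤ ·) : List (Fin (p + q))).length *
      ((↑T⁻¹ : Cl p q) * top β * T) := h.list_prod hc _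
  rw [length_sort, card_univ, Fintype.card_fin, hpow, mul_assoc, (hβ.commute_top_all hn _).eq,
    Units.inv_mul_cancel_left] at h1
  rw [h1, ← mul_assoc, hcc, one_mul]

lemma Rel.rel_iff (hβ : Anticommutes β) (hγ : Anticommutes γ) (hn : Odd (p + q))
    (hc : ∀ x, Commute c x) (h : Rel β γ c T) (T' : (Cl p q)ˣ) :
    Rel β γ c T' ↔ ∃ z : (Cl p q)ˣ, (z : Cl p q) ∈ Subalgebra.center ℂ (Cl p q) ∧ T' = z * T := by
  have hcc := h.mul_self hβ hγ hn.pos hc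
  constructor
  · intro h'
    -- Both conjugations agree once c is cancelled by c² = 1; what commutes with all β^a lies in the
    -- span of 1 and e^{1…n}, hence is central.
    have hcomm : ∀ a, Commute ((T' * T⁻¹ : (Cl p q)ˣ) : Cl p q) (β a) := by
      intro a
      have h1 : c * (c * ((↑T⁻¹ : Cl p q) * β a * T)) =
          c * (c * ((↑T'⁻¹ : Cl p q) * β a * T')) := by
        rw [← h a, ← h' a]
      rw [← mul_assoc c c, ← mul_assoc c c, hcc, one_mul, one_mul] at h1
      rw [commute_iff_eq, Units.val_mul]
      calc (T' : Cl p q) * (↑T⁻¹ : Cl p q) * β a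
          = T' * ((↑T⁻¹ : Cl p q) * β a * T) * (↑T⁻¹ : Cl p q) := by simp [mul_assoc]
        _ = _ := by rw [h1]; simp [← mul_assoc]
    obtain ⟨a, b, hab⟩ := hβ.exists_of_mem_evenCentralizer hn
      (mem_evenCentralizer.2 fun A _ => commute_mprod_of_commute hcomm A)
    refine ⟨T' * T⁻¹, Subalgebra.mem_center_iff.2 fun x => ?_, by simp⟩
    rw [hab]
    exact (commute_smul_one_add_smul_vol hn a b x).symm
  · rintro ⟨z, hz, rfl⟩ a
    rw [h a, mul_inv_rev, Units.val_mul, Units.val_mul]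
    congr 1
    have hz' := Subalgebra.mem_center_iff.1 hz (β a)
    calc _ = (↑T⁻¹ : Cl p q) * ((↑z⁻¹ : Cl p q) * (z * β a)) * T := by
          rw [← mul_assoc (↑z⁻¹ : Cl p q), Units.inv_mul, one_mul]
      _ = _ := by rw [← hz']; simp only [mul_assoc]

end Relations

/-! ### The six factors. -/

section Cases

variable {β γ : Fin (p + q) → Cl p q}

/-- Coordinates of the six factors with respect to `1` and `e^{1…n}`. -/
noncomputable def factorCoeff : Fin 6 → ℂ × ℂ :=
  ![(1, 0), (-1, 0), (0, 1), (0, -1), (0, Complex.I), (0, -Complex.I)]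

lemma factor_eq (k : Fin 6) :
    factor p q k = (factorCoeff k).1 • (1 : Cl p q) + (factorCoeff k).2 • vol p q := by
  fin_cases k <;> simp [factor, factorCoeff]

lemma factorCoeff_injective : Function.Injective factorCoeff := by
  have h1 : (1 : ℂ) ≠ -1 := by norm_num
  have h2 : (1 : ℂ) ≠ Complex.I := fun h => by simpa using congrArg Complex.re h
  have h3 : (1 : ℂ) ≠ -Complex.I := fun h => by simpa using congrArg Complex.re h
  have h4 : (-1 : ℂ) ≠ Complex.I := fun h => by simpa using congrArg Complex.re h
  have h5 : Complex.I ≠ -Complex.I := self_ne_neg.2 Complex.I_ne_zero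
  intro i j hij
  fin_cases i <;> fin_cases j <;>
    simp [factorCoeff, h1, h1.symm, h2, h2.symm, h3, h3.symm, h4, h4.symm, h5, h5.symm] at hij ⊢

lemma commute_factor (hn : Odd (p + q)) (k : Fin 6) (x : Cl p q) : Commute (factor p q k) x := by
  rw [factor_eq]; exact commute_smul_one_add_smul_vol hn _ _ x

lemma factor_injective (hn : Odd (p + q)) : Function.Injective (factor p q) := by
  intro i j hij
  rw [factor_eq, factor_eq] at hij
  exact factorCoeff_injective (Prod.ext_iff.2 (smul_one_add_smul_vol_inj hn hij))

/-- Each top product is ±e^{1…n} or ±τ. Two of the same kind differ by a sign; two of different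
kinds differ by ±τ e^{1…n}, because τ⁴ = 1. Taking τ = 1 or τ = i then gives the two lists of cases.
-/
lemma exists_top_eq_mul_top (hβ : Anticommutes β) (hγ : Anticommutes γ) (hn : Odd (p + q)) {τ : ℂ}
    (hτ : τ * τ = (-1) ^ ((p + q).choose 2 + q)) :
    ∃ u : ℂ, (u = 1 ∨ u = -1) ∧ (top β = (u • (1 : Cl p q)) * top γ ∨
      top β = (u • τ • vol p q) * top γ) := by
  have hr : (τ * τ) * (τ * τ) = 1 := by rw [hτ, ← mul_pow]; norm_num
  have hform : ∀ {δ : Fin (p + q) → Cl p q}, Anticommutes δ → ∃ s : ℂ, s * s = 1 ∧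
      (top δ = s • vol p q ∨ top δ = (s * τ) • (1 : Cl p q)) := by
    intro δ hδ
    rcases hδ.top_eq hn hτ with (h | h) | (h | h)
    · exact ⟨1, by norm_num, .inl (by rw [h, one_smul])⟩
    · exact ⟨-1, by norm_num, .inl (by rw [h, neg_one_smul])⟩
    · exact ⟨1, by norm_num, .inr (by rw [h, one_mul])⟩
    · exact ⟨-1, by norm_num, .inr (by rw [h, neg_one_mul, neg_smul])⟩
  obtain ⟨s, hs, hsβ⟩ := hform hβ
  obtain ⟨t, ht, htγ⟩ := hform hγ
  have hvol : vol p q * vol p q = (τ * τ) • (1 : Cl p q) := by rw [vol_mul_vol, hτ]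
  rcases hsβ with hsβ | hsβ <;> rcases htγ with htγ | htγ
  · refine ⟨s * t, mul_self_eq_one_iff.1 (by linear_combination t * t * hs + ht), .inl ?_⟩
    rw [hsβ, htγ, smul_mul_smul_comm, one_mul]
    congr 1; linear_combination -s * ht
  · refine ⟨s * t * (τ * τ), mul_self_eq_one_iff.1
      (by linear_combination (t * t * τ ^ 4) * hs + τ ^ 4 * ht + hr), .inr ?_⟩
    rw [hsβ, htγ, smul_smul, smul_mul_smul_comm, mul_one]
    congr 1; linear_combination -s * τ ^ 4 * ht - s * hr
  · refine ⟨s * t * (τ * τ), mul_self_eq_one_iff.1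
      (by linear_combination (t * t * τ ^ 4) * hs + τ ^ 4 * ht + hr), .inr ?_⟩
    rw [hsβ, htγ, smul_smul, smul_mul_smul_comm, hvol, smul_smul]
    congr 1; linear_combination -s * τ ^ 5 * ht - s * τ * hr
  · refine ⟨s * t, mul_self_eq_one_iff.1 (by linear_combination t * t * hs + ht), .inl ?_⟩
    rw [hsβ, htγ, smul_mul_smul_comm, one_mul]
    congr 1; linear_combination -s * τ * ht

lemma exists_factor_of_one (hβ : Anticommutes β) (hγ : Anticommutes γ) (hn : Odd (p + q))
    (hε : (-1 : ℂ) ^ ((p + q).choose 2 + q) = 1) :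
    ∃ k ∈ ({0, 1, 2, 3} : Set (Fin 6)), top β = factor p q k * top γ := by
  obtain ⟨u, rfl | rfl, h | h⟩ := exists_top_eq_mul_top hβ hγ hn (τ := 1) (by rw [hε, one_mul])
  · exact ⟨0, by simp, by simpa [factor] using h⟩
  · exact ⟨2, by simp, by simpa [factor] using h⟩
  · exact ⟨1, by simp, by simpa [factor] using h⟩
  · exact ⟨3, by simp, by simpa [factor] using h⟩

lemma exists_factor_of_neg_one (hβ : Anticommutes β) (hγ : Anticommutes γ) (hn : Odd (p + q))
    (hε : (-1 : ℂ) ^ ((p + q).choose 2 + q) = -1) :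
    ∃ k ∈ ({0, 1, 4, 5} : Set (Fin 6)), top β = factor p q k * top γ := by
  obtain ⟨u, rfl | rfl, h | h⟩ := exists_top_eq_mul_top hβ hγ hn (τ := Complex.I)
    (by rw [hε, Complex.I_mul_I])
  · exact ⟨0, by simp, by simpa [factor] using h⟩
  · exact ⟨4, by simp, by simpa [factor] using h⟩
  · exact ⟨1, by simp, by simpa [factor] using h⟩
  · exact ⟨5, by simp, by simpa [factor] using h⟩

lemma existsUnique_factor (hβ : Anticommutes β) (hγ : Anticommutes γ) (hn : Odd (p + q)) :
    ∃! k : Fin 6, top β = factor p q k * top γ := by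
  have hex : ∃ k : Fin 6, top β = factor p q k * top γ := by
    rcases neg_one_pow_eq_or ℂ ((p + q).choose 2 + q) with h | h
    · obtain ⟨k, -, hk⟩ := exists_factor_of_one hβ hγ hn h; exact ⟨k, hk⟩
    · obtain ⟨k, -, hk⟩ := exists_factor_of_neg_one hβ hγ hn h; exact ⟨k, hk⟩
  obtain ⟨k, hk⟩ := hex
  exact ⟨k, hk, fun j hj => factor_injective hn (hγ.isUnit_top.mul_right_cancel (hj.symm.trans hk))⟩

lemma exists_rel_HEven (hβ : Anticommutes β) (hγ : Anticommutes γ) (hn : Odd (p + q)) {k : Fin 6}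
    (hk : top β = factor p q k * top γ) :
    ∃ A B : Finset (Fin (p + q)), Even A.card ∧ Even B.card ∧
      ∃ T : (Cl p q)ˣ, (T : Cl p q) = HEven β γ (mprod γ A + mprod γ B) ∧
        Rel β γ (factor p q k) T := by
  obtain ⟨A, B, hA, hB, T, hT⟩ := exists_isUnit_HEven hβ hγ hn
  refine ⟨A, B, hA, hB, T, hT, rel_of_intertwines hβ hγ hn (commute_factor hn k) hk fun D hD => ?_⟩
  rw [hT]
  exact mprod_mul_HEven hβ hγ hD _

lemma mul_inverse_top_eq (hγ : Anticommutes γ) {c : Cl p q} (h : top β = c * top γ) :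
    top β * Ring.inverse (top γ) = c := by
  rw [h, mul_assoc, Ring.mul_inverse_cancel _ hγ.isUnit_top, mul_one]

end Cases

end PauliClifford

open PauliClifford in
theorem theorem18 (p q : ℕ) (hn : Odd (p + q)) (γ β : Fin (p + q) → Cl p q)
    (hγ : Anticommutes γ) (hβ : Anticommutes β) :
    -- signature `p - q ≡ 1 mod 4`: values of the top products, and only cases 1-4 occur
    ((p : ℤ) - (q : ℤ) ≡ 1 [ZMOD 4] →
      (∀ δ ∈ ({γ, β} : Set (Fin (p + q) → Cl p q)),
        ((top δ = vol p q ∨ top δ = -vol p q) ∧ GeneratesBasis δ) ∨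
        ((top δ = 1 ∨ top δ = -1) ∧ ¬ GeneratesBasis δ)) ∧
      ∃ k ∈ ({0, 1, 2, 3} : Set (Fin 6)), top β = factor p q k * top γ) ∧
    -- signature `p - q ≡ 3 mod 4`: values of the top products, and only cases 1, 2, 5, 6 occur
    ((p : ℤ) - (q : ℤ) ≡ 3 [ZMOD 4] →
      (∀ δ ∈ ({γ, β} : Set (Fin (p + q) → Cl p q)),
        ((top δ = vol p q ∨ top δ = -vol p q) ∧ GeneratesBasis δ) ∨
        ((top δ = Complex.I • (1 : Cl p q) ∨ top δ = -(Complex.I • (1 : Cl p q))) ∧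
          ¬ GeneratesBasis δ)) ∧
      ∃ k ∈ ({0, 1, 4, 5} : Set (Fin 6)), top β = factor p q k * top γ) ∧
    -- exactly one of the six cases occurs
    (∃! k : Fin 6, top β = factor p q k * top γ) ∧
    -- the six equivalences
    (∀ k : Fin 6, (∃ T : (Cl p q)ˣ, Rel β γ (factor p q k) T) ↔
      top β = factor p q k * top γ) ∧
    -- `T` is unique exactly up to an invertible element of the center
    (∀ (k : Fin 6) (T T' : (Cl p q)ˣ), Rel β γ (factor p q k) T →
      (Rel β γ (factor p q k) T' ↔
        ∃ z : (Cl p q)ˣ, (z : Cl p q) ∈ Subalgebra.center ℂ (Cl p q) ∧ T' = z * T)) ∧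
    -- the unified form of the six relations
    (∀ T : (Cl p q)ˣ, (∃ k : Fin 6, Rel β γ (factor p q k) T) ↔
      Rel β γ (top β * Ring.inverse (top γ)) T) ∧
    -- `T` can be taken to be `H_Even(γ^A + γ^B)` with `|A|`, `|B|` even
    (∀ k : Fin 6, top β = factor p q k * top γ →
      ∃ A B : Finset (Fin (p + q)), Even A.card ∧ Even B.card ∧
        ∃ T : (Cl p q)ˣ, (T : Cl p q) = HEven β γ (mprod γ A + mprod γ B) ∧
          Rel β γ (factor p q k) T) := by
  refine ⟨fun h1 => ?_, fun h3 => ?_, existsUnique_factor hβ hγ hn, fun k => ⟨?_, fun hk => ?_⟩,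
    fun k T T' h => h.rel_iff hβ hγ hn (commute_factor hn k) T', fun T => ⟨?_, fun h => ?_⟩,
    fun k hk => exists_rel_HEven hβ hγ hn hk⟩
  · have hε := neg_one_pow_of_modEq_one h1
    refine ⟨fun δ hδ => ?_, exists_factor_of_one hβ hγ hn hε⟩
    have hδ' : Anticommutes δ := by rcases hδ with rfl | rfl <;> assumption
    rcases hδ'.top_eq hn (τ := 1) (by rw [hε, one_mul]) with h | h
    · exact .inl ⟨h, hδ'.generatesBasis hn h⟩
    · refine .inr ⟨by simpa using h, ?_⟩
      rcases h with h | h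
      · exact not_generatesBasis hn.pos h
      · exact not_generatesBasis hn.pos (c := -1) (by rw [h, neg_smul])
  · have hε := neg_one_pow_of_modEq_three h3
    refine ⟨fun δ hδ => ?_, exists_factor_of_neg_one hβ hγ hn hε⟩
    have hδ' : Anticommutes δ := by rcases hδ with rfl | rfl <;> assumption
    rcases hδ'.top_eq hn (τ := Complex.I) (by rw [hε, Complex.I_mul_I]) with h | h
    · exact .inl ⟨h, hδ'.generatesBasis hn h⟩
    · refine .inr ⟨h, ?_⟩
      rcases h with h | h
      · exact not_generatesBasis hn.pos h
      · exact not_generatesBasis hn.pos (c := -Complex.I) (by rw [h, neg_smul])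
  · rintro ⟨T, hT⟩
    exact hT.top_eq hβ hγ hn (commute_factor hn k)
  · obtain ⟨_, _, _, _, T, _, hT⟩ := exists_rel_HEven hβ hγ hn hk
    exact ⟨T, hT⟩
  · rintro ⟨k, hk⟩
    rwa [mul_inverse_top_eq hγ (hk.top_eq hβ hγ hn (commute_factor hn k))]
  · obtain ⟨k, hk, -⟩ := existsUnique_factor hβ hγ hn
    exact ⟨k, by rwa [mul_inverse_top_eq hγ hk] at h⟩
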